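/- **Preliminaries.** Fix countably infinite disjoint sets of constants, nulls and variables, and predicates of positive arity. A database is a finite set of atoms over constants; an instance is a set of atoms over constants and nulls. A TGD $\sigma$ is a constant-free sentence $\forall\bar x\,\forall\bar y\,(\phi(\bar x,\bar y)\to\exists\bar z\,\psi(\bar x,\bar z))$ with $\phi$ (the body) and $\psi$ (the head) non-empty conjunctions of atoms over variables; its frontier consists of the variables occurring in both body and head. It is guarded if some body atom contains all the variables of the body. $\mathsf{G}$ is the class of finite sets of guarded TGDs; as usual, no two TGDs of a set share a variable. For a set $\Sigma$ of TGDs, $\mathsf{sch}(\Sigma)$ is the set of predicates occurring in $\Sigma$ and $\mathsf{ar}(\Sigma)$ is their maximum arity. A trigger for $\Sigma$ on an instance $I$ is a pair $(\sigma,h)$ with $\sigma\in\Sigma$ and $h$ a homomorphism from the body of $\sigma$ to $I$. Its result is the image of the head under the map that is $h$ on the frontier and sends every other head variable $x$ to the null $\bot^{x}_{\sigma,g}$ named by $x$, $\sigma$ and the restriction $g$ of $h$ to the frontier (distinct names denote distinct nulls). The trigger is active on $I$ if its result is not contained in $I$. A (semi-oblivious) chase derivation of a database $D$ w.r.t. $\Sigma$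 starts from $I_0=D$, and each $I_{i+1}$ is the union of $I_i$ and the result of some trigger active on $I_i$; it is either finite, with no active trigger on its last instance, or infinite. It is valid if it is finite, or infinite and fair (each trigger active on some $I_i$ is not active on some $I_j$ with $j>i$). Its result is the union of its instances. $\mathsf{CT}_D$ is the class of sets $\Sigma$ such that every (equivalently, some) valid chase derivation of $D$ w.r.t. $\Sigma$ is finite, and $\mathsf{chase}(D,\Sigma)$ denotes the result of a valid chase derivation of $D$ w.r.t. $\Sigma$ (it does not depend on the derivation). **Theorem.** There exist a family of databases $(D_\ell)_{\ell>0}$ with $|D_\ell|=\ell$ and a family $(\Sigma_{n,m})_{n,m>0}$ of sets of TGDs such that, for all integers $\ell,n,m>0$, we have $\Sigma_{n,m}\in\mathsf{G}\cap\mathsf{CT}_{D_\ell}$, $n=\frac{|\mathsf{sch}(\Sigma_{n,m})|}{4}-3$, $m=\frac{\mathsf{ar}(\Sigma_{n,m})}{2}-2$, and $$|\mathsf{chase}(D_\ell,\Sigma_{n,m})|\ \ge\ \ell\cdot 2^{\,2^n\cdot\left(2^{2^m}-1\right)}.$$ -/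

import Mathlib

namespace SOChase

/-- Constants (a countably infinite set). -/
abbrev Const := ℕ

/-- Variables (a countably infinite set). -/
abbrev Var := ℕ

/-- Relation symbols with their positive arity. There are infinitely many of each arity. -/
structure Pred where
  name : ℕ
  arity : ℕ
  arity_pos : 0 < arity

/-- An atom `R(t₁,…,tₙ)` whose arguments are taken from `T`. -/
structure Atom (T : Type) where
  pred : Pred
  args : Fin pred.arity → T

/-- Applying a substitution to an atom. -/
def Atom.map {T T' : Type} (f : T → T') (α : Atom T) : Atom T' :=
  ⟨α.pred, fun i => f (α.args i)⟩

/-- The set of terms that occur in an atom. -/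
def Atom.terms {T : Type} (α : Atom T) : Set T := Set.range α.args

/-- The variables that occur in a conjunction of atoms. -/
def varsOf (A : List (Atom Var)) : Set Var := {x | ∃ α ∈ A, x ∈ α.terms}

/-- A (constant-free) tuple-generating dependency `body → ∃ z̄ head`. Body and head are non-empty
conjunctions of atoms over variables; the head variables that do not occur in the body are the
existentially quantified ones. -/
structure TGD where
  body : List (Atom Var)
  head : List (Atom Var)
  body_ne : body ≠ []
  head_ne : head ≠ []

/-- All variables of a TGD. -/
def TGD.vars (σ : TGD) : Set Var := varsOf σ.body ∪ varsOf σ.head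

/-- The frontier: the variables that appear both in the body and in the head. -/
def TGD.frontier (σ : TGD) : Set Var := varsOf σ.body ∩ varsOf σ.head

/-- A TGD is guarded if some body atom contains all the variables of the body. -/
def TGD.IsGuarded (σ : TGD) : Prop := ∃ α ∈ σ.body, varsOf σ.body ⊆ α.terms

/-- The predicates that occur in a TGD. -/
def TGD.preds (σ : TGD) : Set Pred := {R | ∃ α ∈ σ.body ++ σ.head, α.pred = R}

/-- The class of all finite sets of guarded TGDs. -/
def ClassG : Set (Set TGD) := {S | S.Finite ∧ ∀ σ ∈ S, σ.IsGuarded}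

/-- No two TGDs of the set share a variable. -/
def VarDisjoint (S : Set TGD) : Prop := ∀ σ ∈ S, ∀ τ ∈ S, σ ≠ τ → Disjoint σ.vars τ.vars

/-- The schema of a set of TGDs: the predicates occurring in it. -/
def sch (S : Set TGD) : Set Pred := ⋃ σ ∈ S, σ.preds

/-- The maximum arity over the predicates of the schema. -/
noncomputable def maxArity (S : Set TGD) : ℕ := sSup (Pred.arity '' sch S)

/-- Constants and labelled nulls. `null σ g x` is the null `⊥^x_{σ,g}`, named by a TGD `σ`,
an assignment `g` of terms to the frontier of `σ`, and a variable `x`. -/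
inductive Term : Type
  | const (c : Const) : Term
  | null (σ : TGD) (g : σ.frontier → Term) (x : Var) : Term

/-- A (possibly infinite) set of atoms over constants and nulls. -/
abbrev Instance := Set (Atom Term)

/-- A finite set of facts, i.e. of atoms all of whose arguments are constants. -/
abbrev Database := Finset (Atom Const)

/-- A database seen as an instance. -/
def Database.toInstance (D : Database) : Instance := Atom.map Term.const '' (D : Set (Atom Const))

/-- `(σ, h)` is a trigger for `S` on `I`: `σ ∈ S` and `h` maps every body atom of `σ` into `I`.
Only the values of `h` on the variables of the body of `σ` matter, here and below. -/
def IsTrigger (S : Set TGD) (I : Instance) (σ : TGD) (h : Var → Term) : Prop :=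
  σ ∈ S ∧ ∀ α ∈ σ.body, α.map h ∈ I

open Classical in
/-- The substitution `μ` on head variables: `h` on the frontier, and elsewhere the null that is
determined by `σ`, by the restriction of `h` to the frontier, and by the variable. -/
noncomputable def headSubst (σ : TGD) (h : Var → Term) (x : Var) : Term :=
  if x ∈ σ.frontier then h x else Term.null σ (fun y => h y) x

/-- The result of a trigger: the image of the head under `μ`. -/
def result (σ : TGD) (h : Var → Term) : Instance :=
  {β | ∃ α ∈ σ.head, β = α.map (headSubst σ h)}

/-- A trigger is active on `I` if its result is not contained in `I`. -/
def IsActiveTrigger (S : Set TGD) (I : Instance) (σ : TGD) (h : Var → Term) : Prop :=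
  IsTrigger S I σ h ∧ ¬ result σ h ⊆ I

/-- `J` is obtained from `I` by the application of one active trigger for `S` on `I`. -/
def ChaseStep (S : Set TGD) (I J : Instance) : Prop :=
  ∃ σ h, IsActiveTrigger S I σ h ∧ J = I ∪ result σ h

/-- `I₀,…,Iₙ` is a finite (semi-oblivious) chase derivation of `D` with respect to `S`. -/
def IsFiniteDerivation (D : Database) (S : Set TGD) (n : ℕ) (I : Fin (n + 1) → Instance) : Prop :=
  I 0 = D.toInstance ∧
  (∀ i : Fin n, ChaseStep S (I i.castSucc) (I i.succ)) ∧
  ∀ σ h, ¬ IsActiveTrigger S (I (Fin.last n)) σ h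

/-- `I₀,I₁,…` is an infinite (semi-oblivious) chase derivation of `D` with respect to `S`. -/
def IsInfiniteDerivation (D : Database) (S : Set TGD) (I : ℕ → Instance) : Prop :=
  I 0 = D.toInstance ∧ ∀ i, ChaseStep S (I i) (I (i + 1))

/-- Fairness of an infinite sequence of instances: every active trigger is deactivated later. -/
def IsFair (S : Set TGD) (I : ℕ → Instance) : Prop :=
  ∀ i σ h, IsActiveTrigger S (I i) σ h → ∃ j, i < j ∧ ¬ IsActiveTrigger S (I j) σ h

/-- `J` is the result of a valid chase derivation (finite, or infinite and fair) of `D` with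
respect to `S`. -/
def IsChaseResult (D : Database) (S : Set TGD) (J : Instance) : Prop :=
  (∃ n, ∃ I : Fin (n + 1) → Instance, IsFiniteDerivation D S n I ∧ J = I (Fin.last n)) ∨
  (∃ I : ℕ → Instance, IsInfiniteDerivation D S I ∧ IsFair S I ∧ J = ⋃ i, I i)

/-- The sets of TGDs for which every valid chase derivation of `D` is finite. -/
def CTforall (D : Database) : Set (Set TGD) :=
  {S | ¬ ∃ I : ℕ → Instance, IsInfiniteDerivation D S I ∧ IsFair S I}

/-- The sets of TGDs for which some valid chase derivation of `D` is finite. -/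
def CTexists (D : Database) : Set (Set TGD) :=
  {S | ∃ n, ∃ I : Fin (n + 1) → Instance, IsFiniteDerivation D S n I}

end SOChase

namespace SOChase

/-! ### Closed instances bound the chase -/

/-! Put `N = n + 1` and `K = (N + 1) * 2 ^ m`. Every node carries a binary counter of `K` bits. For
each position `p` holding 0 it has two children, in which `p` is set and all lower bits are cleared.
Counters increase along branches, so the forest is finite. Yet each increment offers two choices,
and counting through the `K - 1` bits below the top one takes `2 ^ (K - 1) - 1` increments; hence
each root has at least `2 ^ (2 ^ (K - 1) - 1)` descendants with the all-ones counter.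

A position is a block, recorded in the predicate, and an `m`-bit address, recorded in the arguments;
rules contain no constants, so each atom carries the two bit terms along. An edge atom holds parent,
child, the incremented address and a second address that `flip` runs through all values. It
therefore guards `update`, which compares the two addresses (one rule per comparison pattern) and
writes one bit of the child: copied above the increment, 1 at it, 0 below. Only `branch` creates
nulls, and their names determine parent, position and choice. `start` makes each root its own parent
by a loop at the top position, so `update` also initialises the root.

A finite closed instance containing the database bounds every derivation
(`IsChaseResult.closed_and_subset`). `counterModel` is one, which gives termination; conversely
every finite closed instance containing the database is large (`IsClosedUnder.le_ncard`). -/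

/-- An instance is closed under `S` if it has no active trigger. -/
def IsClosedUnder (S : Set TGD) (M : Instance) : Prop := ∀ σ h, ¬ IsActiveTrigger S M σ h

theorem ChaseStep.subset_of_isClosedUnder {S : Set TGD} {M I J : Instance}
    (hM : IsClosedUnder S M) (hI : I ⊆ M) (h : ChaseStep S I J) : J ⊆ M := by
  obtain ⟨σ, g, ⟨⟨hσ, hb⟩, -⟩, rfl⟩ := h
  refine Set.union_subset hI ?_
  by_contra hr
  exact hM σ g ⟨⟨hσ, fun α hα => hI (hb α hα)⟩, hr⟩

theorem ChaseStep.ssubset {S : Set TGD} {I J : Instance} (h : ChaseStep S I J) : I ⊂ J := by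
  obtain ⟨σ, g, ⟨-, hr⟩, rfl⟩ := h
  refine ⟨Set.subset_union_left, fun hs => hr (Set.subset_union_right.trans hs)⟩

theorem not_isInfiniteDerivation {D : Database} {S : Set TGD} {M : Instance} (hfin : M.Finite)
    (hM : IsClosedUnder S M) (hD : D.toInstance ⊆ M) (I : ℕ → Instance) :
    ¬ IsInfiniteDerivation D S I := by
  rintro ⟨h0, hs⟩
  have hsub : ∀ i, I i ⊆ M := by
    intro i
    induction i with
    | zero => exact h0 ▸ hD
    | succ i ih => exact (hs i).subset_of_isClosedUnder hM ih
  have hmono : StrictMono fun i => (I i).ncard :=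
    strictMono_nat_of_lt_succ fun i => Set.ncard_lt_ncard (hs i).ssubset (hfin.subset (hsub _))
  have h1 := hmono.id_le (M.ncard + 1)
  have h2 := Set.ncard_le_ncard (hsub (M.ncard + 1)) hfin
  simp only [id_eq] at h1
  omega

theorem mem_CTforall_of_isClosedUnder {D : Database} {S : Set TGD} {M : Instance}
    (hfin : M.Finite) (hM : IsClosedUnder S M) (hD : D.toInstance ⊆ M) : S ∈ CTforall D :=
  fun ⟨I, hI, _⟩ => not_isInfiniteDerivation hfin hM hD I hI

/-- `k` bounds the number of atoms of `M` still missing, and each step uses up at least one of them.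
-/
theorem exists_finite_sequence_of_isClosedUnder {S : Set TGD} {M : Instance} (hfin : M.Finite)
    (hM : IsClosedUnder S M) (k : ℕ) : ∀ I : Instance, I ⊆ M → M.ncard ≤ I.ncard + k →
      ∃ n, ∃ F : Fin (n + 1) → Instance, F 0 = I ∧
        (∀ i : Fin n, ChaseStep S (F i.castSucc) (F i.succ)) ∧
        IsClosedUnder S (F (Fin.last n)) := by
  induction k with
  | zero =>
    intro I hI hk
    obtain rfl := Set.eq_of_subset_of_ncard_le hI hk hfin
    exact ⟨0, fun _ => I, rfl, fun i => i.elim0, hM⟩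
  | succ k ih =>
    intro I hI hk
    by_cases hc : IsClosedUnder S I
    · exact ⟨0, fun _ => I, rfl, fun i => i.elim0, hc⟩
    · simp only [IsClosedUnder, not_forall, not_not] at hc
      obtain ⟨σ, h, hact⟩ := hc
      have hst : ChaseStep S I (I ∪ result σ h) := ⟨σ, h, hact, rfl⟩
      have hJ := hst.subset_of_isClosedUnder hM hI
      have hlt := Set.ncard_lt_ncard hst.ssubset (hfin.subset hJ)
      obtain ⟨n, F, h0, hs, hl⟩ := ih _ hJ (by omega)
      refine ⟨n + 1, Fin.cons I F, rfl, fun i => ?_, ?_⟩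
      · refine Fin.cases ?_ (fun i => ?_) i
        · simpa [h0] using hst
        · simpa using hs i
      · rw [← Fin.succ_last, Fin.cons_succ]
        exact hl

theorem mem_CTexists_of_isClosedUnder {D : Database} {S : Set TGD} {M : Instance}
    (hfin : M.Finite) (hM : IsClosedUnder S M) (hD : D.toInstance ⊆ M) : S ∈ CTexists D := by
  obtain ⟨n, F, h0, hs, hl⟩ :=
    exists_finite_sequence_of_isClosedUnder hfin hM M.ncard _ hD (Nat.le_add_left _ _)
  exact ⟨n, F, h0, hs, hl⟩

theorem IsChaseResult.closed_and_subset {D : Database} {S : Set TGD} {M J : Instance}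
    (hfin : M.Finite) (hM : IsClosedUnder S M) (hD : D.toInstance ⊆ M)
    (hJ : IsChaseResult D S J) : IsClosedUnder S J ∧ D.toInstance ⊆ J ∧ J ⊆ M := by
  rcases hJ with ⟨n, I, ⟨h0, hs, hl⟩, rfl⟩ | ⟨I, hI, -, -⟩
  · have key : ∀ i : Fin (n + 1), D.toInstance ⊆ I i ∧ I i ⊆ M := by
      intro i
      induction i using Fin.induction with
      | zero => exact ⟨h0.ge, h0.le.trans hD⟩
      | succ i ih =>
        exact ⟨ih.1.trans (hs i).ssubset.subset, (hs i).subset_of_isClosedUnder hM ih.2⟩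
    exact ⟨hl, key _⟩
  · exact absurd hI (not_isInfiniteDerivation hfin hM hD I)

/-! ### Binary counters over a finite linear order -/

section Counting

variable {P : Type} [LinearOrder P]

/-- Set the bit at `p` and reset all the lower ones. -/
def carryAt (s : P → Bool) (p q : P) : Bool :=
  if q < p then false else if q = p then true else s q

/-- The order of binary counters, where greater positions are more significant. -/
def CounterLT (s t : P → Bool) : Prop :=
  ∃ p, s p = false ∧ t p = true ∧ ∀ q, p < q → s q = t q

theorem counterLT_carryAt {s : P → Bool} {p : P} (h : s p = false) :
    CounterLT s (carryAt s p) := by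
  refine ⟨p, h, by simp [carryAt], fun q hq => ?_⟩
  simp [carryAt, hq.not_gt, hq.ne']

/-- On a finite type a strict order suffices; for transitivity, the higher of the two deciding
positions decides. -/
theorem wellFounded_counterLT [Finite P] : WellFounded (CounterLT (P := P)) := by
  have : Std.Irrefl (CounterLT (P := P)) := ⟨fun s ⟨p, h1, h2, _⟩ => by simp [h1] at h2⟩
  have : IsTrans (P → Bool) CounterLT := ⟨by
    rintro s t u ⟨p, h1, h2, h3⟩ ⟨q, k1, k2, k3⟩
    rcases lt_trichotomy p q with h | rfl | h
    · exact ⟨q, (h3 q h).trans k1, k2, fun r hr => (h3 r (h.trans hr)).trans (k3 r hr)⟩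
    · simp [h2] at k1
    · exact ⟨p, h1, (k3 p h).symm.trans h2, fun r hr => (h3 r hr).trans (k3 r (h.trans hr))⟩⟩
  exact Finite.wellFounded_of_trans_of_irrefl _

/-- Counting from zero to the maximum on the `k` lowest positions, with two choices at each
increment, multiplies the number of objects by `2 ^ (2 ^ k - 1)`. -/
theorem exists_card_mul_two_pow_le {T : Type} {K : ℕ} (e : Fin K ≃o P)
    (Holds : T → (P → Bool) → Prop) (child : Bool → P → T → T)
    (hinj : ∀ p c t c' t', child c p t = child c' p t' → c = c' ∧ t = t')
    (hstep : ∀ t s p c, Holds t s → s p = false → Holds (child c p t) (carryAt s p))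
    (k : ℕ) (hk : k ≤ K) : ∀ (s : P → Bool), (∀ i : Fin K, (i : ℕ) < k → s (e i) = false) →
      ∀ A : Finset T, (∀ t ∈ A, Holds t s) →
        ∃ A' : Finset T, A.card * 2 ^ (2 ^ k - 1) ≤ A'.card ∧
          ∀ t ∈ A', Holds t (fun q => if ((e.symm q : Fin K) : ℕ) < k then true else s q) := by
  classical
  induction k with
  | zero => intro s _ A hA; exact ⟨A, by simp, by simpa using hA⟩
  | succ k ih =>
    intro s hs A hA
    obtain ⟨A₁, hc₁, hA₁⟩ := ih (by omega) s (fun i hi => hs i (by omega)) A hA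
    -- The positions below `k` are now full. Incrementing at the next one clears them, so that they
    -- can be counted through a second time.
    set p : P := e ⟨k, hk⟩ with hp
    set s₁ : P → Bool := fun q => if ((e.symm q : Fin K) : ℕ) < k then true else s q with hs₁
    have hs₁p : s₁ p = false := by simp [hs₁, hp, hs]
    let A₂ : Finset T := (Finset.univ ×ˢ A₁).image fun x : Bool × T => child x.1 p x.2
    -- All elements of `A₁` hold the same counter and are incremented at the same `p`, so
    -- injectivity for fixed `p` is enough.
    have hc₂ : A₂.card = 2 * A₁.card := by
      rw [Finset.card_image_of_injective, Finset.card_product]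
      · simp
      · rintro ⟨c, t⟩ ⟨c', t'⟩ h
        obtain ⟨rfl, rfl⟩ := hinj _ _ _ _ _ h
        rfl
    have hlt : ∀ i : Fin K, e i < p ↔ (i : ℕ) < k := by
      intro i
      rw [hp, e.lt_iff_lt, Fin.lt_def]
    have hlow : ∀ i : Fin K, (i : ℕ) < k → carryAt s₁ p (e i) = false := by
      intro i hi
      simp [carryAt, (hlt i).2 hi]
    obtain ⟨A₃, hc₃, hA₃⟩ := ih (by omega) (carryAt s₁ p) hlow A₂ (by
      intro t ht
      obtain ⟨⟨c, u⟩, hu, rfl⟩ := Finset.mem_image.1 ht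
      exact hstep u s₁ p c (hA₁ u (Finset.mem_product.1 hu).2) hs₁p)
    refine ⟨A₃, ?_, fun t ht => ?_⟩
    -- Two full counts and one carry: `2 ^ (k + 1) - 1 = (2 ^ k - 1) + 1 + (2 ^ k - 1)`.
    · have hpow : 2 ^ (2 ^ (k + 1) - 1) = 2 ^ (2 ^ k - 1) * 2 * 2 ^ (2 ^ k - 1) := by
        rw [← pow_succ, ← pow_add]
        congr 1
        have := Nat.one_le_two_pow (n := k)
        rw [pow_succ]
        omega
      calc A.card * 2 ^ (2 ^ (k + 1) - 1)
          = 2 * (A.card * 2 ^ (2 ^ k - 1)) * 2 ^ (2 ^ k - 1) := by rw [hpow]; ring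
        _ ≤ A₂.card * 2 ^ (2 ^ k - 1) := by rw [hc₂]; gcongr
        _ ≤ A₃.card := hc₃
    · convert hA₃ t ht using 2 with q
      obtain ⟨i, rfl⟩ := e.surjective q
      have hpe : e i = p ↔ (i : ℕ) = k := by
        rw [hp, e.injective.eq_iff, Fin.ext_iff]
      simp only [OrderIso.symm_apply_apply, carryAt, hlt, hpe, hs₁]
      split_ifs <;> first | rfl | omega

end Counting

/-! ### The rules of the counter -/

/-- The argument positions of the atoms of the counter, which also serve as the variables of its
rules: a node `x`, a node `y`, the two bits `z` and `o`, and two addresses `a` and `b`. -/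
inductive LVar (m : ℕ) : Type
  | x | y | z | o
  | a (i : Fin m)
  | b (i : Fin m)

/-- The positions are four terms and two blocks of `m` terms. -/
def LVar.equivSum (m : ℕ) : LVar m ≃ Fin 4 ⊕ (Fin m ⊕ Fin m) where
  toFun
    | .x => .inl 0
    | .y => .inl 1
    | .z => .inl 2
    | .o => .inl 3
    | .a i => .inr (.inl i)
    | .b i => .inr (.inr i)
  invFun
    | .inl 0 => .x
    | .inl 1 => .y
    | .inl 2 => .z
    | .inl 3 => .o
    | .inr (.inl i) => .a i
    | .inr (.inr i) => .b i
  left_inv v := by cases v <;> rfl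
  right_inv v := by
    rcases v with v | v | v
    · fin_cases v <;> rfl
    · rfl
    · rfl

/-- The positions, enumerated. -/
def LVar.equivFin (m : ℕ) : Fin (2 * m + 4) ≃ LVar m :=
  (finCongr (by ring)).trans
    (((LVar.equivSum m).trans ((Equiv.refl _).sumCongr finSumFinEquiv)).trans finSumFinEquiv).symm

instance (m : ℕ) : Finite (LVar m) := Finite.of_equiv _ (LVar.equivFin m)

/-- The argument tuple with the given components. -/
def vec {T : Type} {m : ℕ} (x y z o : T) (a b : Fin m → T) : LVar m → T
  | .x => x
  | .y => y
  | .z => z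
  | .o => o
  | .a i => a i
  | .b i => b i

theorem comp_vec {T T' : Type} {m : ℕ} (f : T → T') (x y z o : T) (a b : Fin m → T) :
    f ∘ vec x y z o a b = vec (f x) (f y) (f z) (f o) (f ∘ a) (f ∘ b) := by
  funext v
  cases v <;> rfl

theorem vec_inj {T : Type} {m : ℕ} {x y z o x' y' z' o' : T} {a b a' b' : Fin m → T} :
    vec x y z o a b = vec x' y' z' o' a' b' ↔
      x = x' ∧ y = y' ∧ z = z' ∧ o = o' ∧ a = a' ∧ b = b' := by
  constructor
  · intro h
    exact ⟨congrFun h .x, congrFun h .y, congrFun h .z, congrFun h .o,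
      funext fun i => congrFun h (.a i), funext fun i => congrFun h (.b i)⟩
  · rintro ⟨rfl, rfl, rfl, rfl, rfl, rfl⟩
    rfl

/-- The relation symbols of arity `2 * m + 4`, for `N + 1` blocks of bits: `bit v j` says that
a bit of the `j`-th block of a node has the value `v`, and `edge c j` that a node has a `c`-th
child which increments a bit of the `j`-th block. -/
inductive Sym (N : ℕ) : Type
  | bit (v : Bool) (j : Fin (N + 1))
  | edge (c : Bool) (j : Fin (N + 1))
  | pad (k : Fin 3)

/-- The relation symbols, as a sum. -/
def Sym.equivSum (N : ℕ) : Sym N ≃ (Bool × Fin (N + 1)) ⊕ (Bool × Fin (N + 1)) ⊕ Fin 3 where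
  toFun
    | .bit v j => .inl (v, j)
    | .edge c j => .inr (.inl (c, j))
    | .pad k => .inr (.inr k)
  invFun
    | .inl (v, j) => .bit v j
    | .inr (.inl (c, j)) => .edge c j
    | .inr (.inr k) => .pad k
  left_inv v := by cases v <;> rfl
  right_inv v := by rcases v with v | v | v <;> rfl

instance (N : ℕ) : Finite (Sym N) := Finite.of_equiv _ (Sym.equivSum N).symm

theorem Sym.card (N : ℕ) : Nat.card (Sym N) = 4 * N + 7 := by
  rw [Nat.card_congr (Sym.equivSum N)]
  simp
  ring

/-- A numbering of the relation symbols. -/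
noncomputable def Sym.code {N : ℕ} : Sym N → ℕ := (Countable.exists_injective_nat (Sym N)).choose

theorem Sym.code_injective {N : ℕ} : Function.Injective (Sym.code (N := N)) :=
  (Countable.exists_injective_nat (Sym N)).choose_spec

/-- The predicate with the given symbol. -/
noncomputable def Sym.toPred {N : ℕ} (m : ℕ) (p : Sym N) : Pred := ⟨p.code, 2 * m + 4, by omega⟩

theorem Sym.toPred_injective {N m : ℕ} : Function.Injective (Sym.toPred (N := N) m) :=
  fun _ _ h => Sym.code_injective (congrArg Pred.name h)

/-- The atom with the given symbol and arguments. -/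
noncomputable def cell {N m : ℕ} {T : Type} (p : Sym N) (f : LVar m → T) : Atom T :=
  ⟨p.toPred m, f ∘ LVar.equivFin m⟩

/-- The predicate of the databases. -/
def rootPred : Pred := ⟨0, 3, by norm_num⟩

/-- The atom that says that `x` is a root and that `z` and `o` are the two bits. -/
def rootAtom {T : Type} (x z o : T) : Atom T := ⟨rootPred, ![x, z, o]⟩

/-! ### Atoms: substitution, terms and injectivity. -/

theorem Atom.map_cell {N m : ℕ} {T T' : Type} (g : T → T') (p : Sym N) (f : LVar m → T) :
    (cell p f).map g = cell p (g ∘ f) := rfl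

theorem Atom.map_rootAtom {T T' : Type} (g : T → T') (x z o : T) :
    (rootAtom x z o).map g = rootAtom (g x) (g z) (g o) := by
  refine congrArg (Atom.mk rootPred) (funext fun (i : Fin 3) => ?_)
  fin_cases i <;> rfl

theorem Atom.map_map {T T' T'' : Type} (f : T → T') (g : T' → T'') (α : Atom T) :
    (α.map f).map g = α.map (g ∘ f) := rfl

theorem Atom.map_congr {T T' : Type} {f g : T → T'} {α : Atom T}
    (h : ∀ t ∈ α.terms, f t = g t) : α.map f = α.map g :=
  congrArg (Atom.mk α.pred) (funext fun i => h _ ⟨i, rfl⟩)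

theorem Atom.terms_map {T T' : Type} (f : T → T') (α : Atom T) :
    (α.map f).terms = f '' α.terms :=
  Set.range_comp f α.args

theorem Atom.terms_cell {N m : ℕ} {T : Type} (p : Sym N) (f : LVar m → T) :
    (cell p f).terms = Set.range f :=
  (LVar.equivFin m).surjective.range_comp f

theorem Atom.mem_terms_rootAtom {T : Type} {x z o t : T} :
    t ∈ (rootAtom x z o).terms ↔ t = x ∨ t = z ∨ t = o := by
  constructor
  · rintro ⟨i, rfl⟩
    change Fin 3 at i
    fin_cases i
    · exact .inl rfl
    · exact .inr (.inl rfl)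
    · exact .inr (.inr rfl)
  · rintro (rfl | rfl | rfl)
    · exact ⟨(0 : Fin 3), rfl⟩
    · exact ⟨(1 : Fin 3), rfl⟩
    · exact ⟨(2 : Fin 3), rfl⟩

theorem cell_inj {N m : ℕ} {T : Type} {p q : Sym N} {f g : LVar m → T} :
    cell p f = cell q g ↔ p = q ∧ f = g := by
  constructor
  · intro h
    obtain ⟨h1, h2⟩ := Atom.mk.inj h
    obtain rfl := Sym.toPred_injective h1
    exact ⟨rfl, (LVar.equivFin m).surjective.injective_comp_right (eq_of_heq h2)⟩
  · rintro ⟨rfl, rfl⟩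
    rfl

theorem rootAtom_inj {T : Type} {x z o x' z' o' : T} :
    rootAtom x z o = rootAtom x' z' o' ↔ x = x' ∧ z = z' ∧ o = o' := by
  constructor
  · intro h
    have h2 := eq_of_heq (Atom.mk.inj h).2
    exact ⟨congrFun h2 (0 : Fin 3), congrFun h2 (1 : Fin 3), congrFun h2 (2 : Fin 3)⟩
  · rintro ⟨rfl, rfl, rfl⟩
    rfl

/-- The arities differ, whatever the code is. Hence the database predicate can be fixed
independently of `N` and `m`. -/
theorem Sym.toPred_ne_rootPred {N m : ℕ} (p : Sym N) : p.toPred m ≠ rootPred := by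
  intro h
  have := congrArg Pred.arity h
  simp only [Sym.toPred, rootPred] at this
  omega

theorem cell_ne_rootAtom {N m : ℕ} {T : Type} (p : Sym N) (f : LVar m → T) (x z o : T) :
    cell p f ≠ rootAtom x z o :=
  fun h => p.toPred_ne_rootPred (congrArg Atom.pred h)

/-- The ways in which two addresses compare lexicographically: they are equal, or they differ
first at the `i`-th bit. -/
inductive Pat (m : ℕ) : Type
  | eq
  | lt (i : Fin m)
  | gt (i : Fin m)

/-- The patterns, as a sum. -/
def Pat.equivSum (m : ℕ) : Pat m ≃ Unit ⊕ Fin m ⊕ Fin m where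
  toFun
    | .eq => .inl ()
    | .lt i => .inr (.inl i)
    | .gt i => .inr (.inr i)
  invFun
    | .inl _ => .eq
    | .inr (.inl i) => .lt i
    | .inr (.inr i) => .gt i
  left_inv v := by cases v <;> rfl
  right_inv v := by rcases v with v | v | v <;> rfl

instance (m : ℕ) : Finite (Pat m) := Finite.of_equiv _ (Pat.equivSum m).symm

/-- The variables for the first of two addresses that compare as the pattern says. -/
def Pat.fst {m : ℕ} : Pat m → Fin m → LVar m
  | .eq, k => .a k
  | .lt i, k => if k = i then .z else .a k
  | .gt i, k => if k = i then .o else .a k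

/-- The variables for the second of two addresses that compare as the pattern says. -/
def Pat.snd {m : ℕ} : Pat m → Fin m → LVar m
  | .eq, k => .a k
  | .lt i, k => if k < i then .a k else if k = i then .o else .b k
  | .gt i, k => if k < i then .a k else if k = i then .z else .b k

/-- Whether the first position is below the second one. -/
def Pat.isBelow {N m : ℕ} (j k : Fin (N + 1)) : Pat m → Bool
  | .lt _ => decide (j ≤ k)
  | _ => decide (j < k)

/-- Whether the two positions are the same. -/
def Pat.isSame {N m : ℕ} (j k : Fin (N + 1)) : Pat m → Bool
  | .eq => decide (j = k)
  | _ => false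

/-- The rules of the counter. -/
inductive Rule (N m : ℕ) : Type
  | start
  | branch (c : Bool) (j : Fin (N + 1))
  | flip (c : Bool) (j : Fin (N + 1)) (i : Fin m)
  | update (c : Bool) (j k : Fin (N + 1)) (p : Pat m) (v : Bool)

/-- The rules, as a sum. -/
def Rule.equivSum (N m : ℕ) : Rule N m ≃ Unit ⊕ (Bool × Fin (N + 1)) ⊕
    (Bool × Fin (N + 1) × Fin m) ⊕ (Bool × Fin (N + 1) × Fin (N + 1) × Pat m × Bool) where
  toFun
    | .start => .inl ()
    | .branch c j => .inr (.inl (c, j))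
    | .flip c j i => .inr (.inr (.inl (c, j, i)))
    | .update c j k p v => .inr (.inr (.inr (c, j, k, p, v)))
  invFun
    | .inl _ => .start
    | .inr (.inl (c, j)) => .branch c j
    | .inr (.inr (.inl (c, j, i))) => .flip c j i
    | .inr (.inr (.inr (c, j, k, p, v))) => .update c j k p v
  left_inv v := by cases v <;> rfl
  right_inv v := by rcases v with v | v | v | v <;> rfl

instance (N m : ℕ) : Finite (Rule N m) := Finite.of_equiv _ (Rule.equivSum N m).symm

/-- The body of a rule. The first atom is a guard. -/
noncomputable def Rule.body {N m : ℕ} : Rule N m → List (Atom (LVar m))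
  | .start => [rootAtom .x .z .o]
  | .branch _ j => [cell (.bit false j) (vec .x .x .z .o .a .a)]
  | .flip c j i => [cell (.edge c j) (vec .x .y .z .o .a (Function.update .b i .z))]
  | .update c j k p v =>
    cell (.edge c j) (vec .x .y .z .o p.fst p.snd) ::
      if p.isBelow j k then [cell (.bit v k) (vec .x .x .z .o p.snd p.snd)] else []

/-- The head of a rule. -/
noncomputable def Rule.head {N m : ℕ} : Rule N m → List (Atom (LVar m))
  | .start =>
    cell (.edge false (Fin.last N)) (vec (m := m) .x .x .z .o (fun _ => .o) (fun _ => .z)) ::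
      (List.finRange 3).map fun k =>
        cell (.pad k : Sym N) (vec (m := m) .x .x .z .o (fun _ => .o) (fun _ => .z))
  | .branch c j => [cell (.edge c j) (vec .x .y .z .o .a fun _ => .z)]
  | .flip c j i => [cell (.edge c j) (vec .x .y .z .o .a (Function.update .b i .o))]
  | .update _ j k p v =>
    [cell (.bit (if p.isBelow j k then v else p.isSame j k) k) (vec .y .y .z .o p.snd p.snd)]

/-! ### From rules over local variables to TGDs with disjoint variables. -/

/-- A numbering of the variables of all rules. -/
noncomputable def varCode {N m : ℕ} : Rule N m × LVar m → Var :=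
  (Countable.exists_injective_nat (Rule N m × LVar m)).choose

theorem varCode_injective {N m : ℕ} : Function.Injective (varCode (N := N) (m := m)) :=
  (Countable.exists_injective_nat (Rule N m × LVar m)).choose_spec

instance (N m : ℕ) : Nonempty (Rule N m × LVar m) := ⟨(.start, .x)⟩

/-- The variable with the given number. -/
noncomputable def varDecode (N : ℕ) {m : ℕ} (w : Var) : LVar m :=
  (Function.invFun (varCode (N := N)) w).2

@[simp]
theorem varDecode_varCode {N m : ℕ} (r : Rule N m) (v : LVar m) :
    varDecode N (varCode (r, v)) = v := by
  rw [varDecode, Function.leftInverse_invFun varCode_injective]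

/-- The rule as a TGD. -/
noncomputable def Rule.tgd {N m : ℕ} (r : Rule N m) : TGD where
  body := r.body.map (Atom.map fun v => varCode (r, v))
  head := r.head.map (Atom.map fun v => varCode (r, v))
  body_ne := by cases r <;> simp [Rule.body]
  head_ne := by cases r <;> simp [Rule.head]

/-- The variables that occur in a list of atoms. -/
def occurs {V : Type} (A : List (Atom V)) : Set V := {x | ∃ α ∈ A, x ∈ α.terms}

theorem varsOf_map {V : Type} (f : V → Var) (A : List (Atom V)) :
    varsOf (A.map (Atom.map f)) = f '' occurs A := by
  ext w
  simp only [varsOf, occurs, List.mem_map, Set.mem_ofPred_eq, Set.mem_image]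
  constructor
  · rintro ⟨_, ⟨α, hα, rfl⟩, hw⟩
    rw [Atom.terms_map] at hw
    obtain ⟨v, hv, rfl⟩ := hw
    exact ⟨v, ⟨α, hα, hv⟩, rfl⟩
  · rintro ⟨v, ⟨α, hα, hv⟩, rfl⟩
    exact ⟨_, ⟨α, hα, rfl⟩, by rw [Atom.terms_map]; exact ⟨v, hv, rfl⟩⟩

theorem Rule.frontier_tgd {N m : ℕ} (r : Rule N m) :
    r.tgd.frontier = (fun v => varCode (r, v)) '' (occurs r.body ∩ occurs r.head) := by
  rw [TGD.frontier, Rule.tgd, varsOf_map, varsOf_map, Set.image_inter]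
  intro v w h
  exact (Prod.ext_iff.1 (varCode_injective h)).2

theorem Rule.varCode_mem_frontier_tgd {N m : ℕ} (r : Rule N m) (v : LVar m) :
    varCode (r, v) ∈ r.tgd.frontier ↔ v ∈ occurs r.body ∧ v ∈ occurs r.head := by
  rw [Rule.frontier_tgd, Set.mem_image]
  constructor
  · rintro ⟨w, hw, h⟩
    obtain rfl := (Prod.ext_iff.1 (varCode_injective h)).2
    exact hw
  · exact fun h => ⟨v, h, rfl⟩

open Classical in
/-- The extension of an assignment for the body of a rule to the head variables. -/
noncomputable def Rule.extend {N m : ℕ} (r : Rule N m) (env : LVar m → Term) (v : LVar m) : Term :=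
  if v ∈ occurs r.body then env v
  else Term.null r.tgd (fun w => env (varDecode N w)) (varCode (r, v))

/-- The two null names agree because the frontier consists of codes of variables of `r`, which
`varDecode` inverts. -/
theorem Rule.headSubst_tgd {N m : ℕ} (r : Rule N m) (h : Var → Term) (v : LVar m)
    (hv : v ∈ occurs r.head) :
    headSubst r.tgd h (varCode (r, v)) = r.extend (fun v => h (varCode (r, v))) v := by
  by_cases hb : v ∈ occurs r.body
  · rw [headSubst, if_pos ((r.varCode_mem_frontier_tgd v).2 ⟨hb, hv⟩), Rule.extend, if_pos hb]
  · rw [headSubst, if_neg (fun hc => hb ((r.varCode_mem_frontier_tgd v).1 hc).1), Rule.extend,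
      if_neg hb]
    congr 1
    funext ⟨w, hw⟩
    rw [Rule.frontier_tgd] at hw
    obtain ⟨u, -, rfl⟩ := hw
    simp

/-- The TGDs of the counter. -/
def counterTGDs (N m : ℕ) : Set TGD := Set.range (Rule.tgd (N := N) (m := m))

/-- Closure is used only in this form, with assignments to local variables; each such `env` arises
from the global assignment `env ∘ varDecode N`. -/
theorem isClosedUnder_counterTGDs {N m : ℕ} {M : Instance} :
    IsClosedUnder (counterTGDs N m) M ↔ ∀ (r : Rule N m) (env : LVar m → Term),
      (∀ α ∈ r.body, α.map env ∈ M) → ∀ α ∈ r.head, α.map (r.extend env) ∈ M := by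
  constructor
  · intro hM r env hb α hα
    set h : Var → Term := fun w => env (varDecode N w) with hh
    have henv : (fun v => h (varCode (r, v))) = env := by
      funext v
      simp [hh]
    have hsub : result r.tgd h ⊆ M := by
      by_contra hc
      refine hM r.tgd h ⟨⟨⟨r, rfl⟩, ?_⟩, hc⟩
      intro β hβ
      obtain ⟨γ, hγ, rfl⟩ := List.mem_map.1 hβ
      have := hb γ hγ
      rwa [← henv] at this
    refine hsub ⟨_, List.mem_map.2 ⟨α, hα, rfl⟩, ?_⟩
    rw [Atom.map_map]
    refine Atom.map_congr fun v hv => ?_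
    rw [Function.comp_apply, r.headSubst_tgd h v ⟨α, hα, hv⟩, henv]
  · rintro hM σ h ⟨⟨⟨r, rfl⟩, hb⟩, hc⟩
    refine hc ?_
    rintro β ⟨γ, hγ, rfl⟩
    obtain ⟨α, hα, rfl⟩ := List.mem_map.1 hγ
    have key := hM r (fun v => h (varCode (r, v)))
      (fun α hα => hb _ (List.mem_map.2 ⟨α, hα, rfl⟩)) α hα
    rw [Atom.map_map]
    convert key using 1
    exact Atom.map_congr fun v hv => r.headSubst_tgd h v ⟨α, hα, hv⟩

/-! ### Syntactic properties -/

/-- Only `update` can have a second body atom, and its variables all occur in the edge atom, which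
holds both nodes and both addresses. -/
theorem Rule.occurs_body_subset {N m : ℕ} (r : Rule N m) :
    ∃ α ∈ r.body, occurs r.body ⊆ α.terms := by
  cases r with
  | start => exact ⟨_, List.mem_singleton_self _, by simp [occurs, Rule.body]⟩
  | branch c j => exact ⟨_, List.mem_singleton_self _, by simp [occurs, Rule.body]⟩
  | flip c j i => exact ⟨_, List.mem_singleton_self _, by simp [occurs, Rule.body]⟩
  | update c j k p v =>
    refine ⟨_, List.mem_cons_self, ?_⟩
    rintro w ⟨α, hα, hw⟩
    rcases List.mem_cons.1 hα with rfl | hα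
    · exact hw
    · split_ifs at hα
      · obtain rfl := List.mem_singleton.1 hα
        rw [Atom.terms_cell] at hw ⊢
        obtain ⟨u, rfl⟩ := hw
        cases u with
        | x => exact ⟨.x, rfl⟩
        | y => exact ⟨.x, rfl⟩
        | z => exact ⟨.z, rfl⟩
        | o => exact ⟨.o, rfl⟩
        | a i => exact ⟨.b i, rfl⟩
        | b i => exact ⟨.b i, rfl⟩
      · simp at hα

theorem counterTGDs_mem_ClassG (N m : ℕ) : counterTGDs N m ∈ ClassG := by
  refine ⟨Set.finite_range _, ?_⟩
  rintro σ ⟨r, rfl⟩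
  obtain ⟨α, hα, hsub⟩ := r.occurs_body_subset
  refine ⟨_, List.mem_map.2 ⟨α, hα, rfl⟩, ?_⟩
  rw [Rule.tgd, varsOf_map, Atom.terms_map]
  exact Set.image_mono hsub

theorem Rule.vars_tgd_subset {N m : ℕ} (r : Rule N m) :
    r.tgd.vars ⊆ Set.range fun v => varCode (r, v) := by
  rw [TGD.vars, Rule.tgd, varsOf_map, varsOf_map]
  exact Set.union_subset (Set.image_subset_range _ _) (Set.image_subset_range _ _)

theorem varDisjoint_counterTGDs (N m : ℕ) : VarDisjoint (counterTGDs N m) := by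
  rintro σ ⟨r, rfl⟩ τ ⟨r', rfl⟩ hne
  refine Set.disjoint_left.2 fun w hw hw' => hne ?_
  obtain ⟨v, rfl⟩ := r.vars_tgd_subset hw
  obtain ⟨v', h⟩ := r'.vars_tgd_subset hw'
  exact congrArg Rule.tgd (Prod.ext_iff.1 (varCode_injective h)).1.symm

theorem Rule.mem_preds_tgd {N m : ℕ} (r : Rule N m) (R : Pred) :
    R ∈ r.tgd.preds ↔ ∃ α ∈ r.body ++ r.head, α.pred = R := by
  simp only [TGD.preds, Rule.tgd, ← List.map_append, Set.mem_ofPred_eq, List.mem_map]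
  constructor
  · rintro ⟨_, ⟨α, hα, rfl⟩, rfl⟩
    exact ⟨α, hα, rfl⟩
  · rintro ⟨α, hα, rfl⟩
    exact ⟨_, ⟨α, hα, rfl⟩, rfl⟩

theorem sch_counterTGDs (N m : ℕ) :
    sch (counterTGDs N m) = insert rootPred (Set.range (Sym.toPred (N := N) m)) := by
  ext R
  simp only [sch, counterTGDs, Set.mem_iUnion, Set.mem_range, exists_prop, exists_exists_eq_and,
    Rule.mem_preds_tgd, Set.mem_insert_iff]
  constructor
  · rintro ⟨r, α, hα, rfl⟩
    cases r with
    | start =>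
      simp only [Rule.body, Rule.head, List.cons_append, List.nil_append, List.mem_cons,
        List.mem_map] at hα
      rcases hα with rfl | rfl | ⟨k, -, rfl⟩
      exacts [.inl rfl, .inr ⟨_, rfl⟩, .inr ⟨_, rfl⟩]
    | branch c j =>
      simp only [Rule.body, Rule.head, List.cons_append, List.nil_append, List.mem_cons,
        List.not_mem_nil, or_false] at hα
      rcases hα with rfl | rfl
      exacts [.inr ⟨_, rfl⟩, .inr ⟨_, rfl⟩]
    | flip c j i =>
      simp only [Rule.body, Rule.head, List.cons_append, List.nil_append, List.mem_cons,
        List.not_mem_nil, or_false] at hα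
      rcases hα with rfl | rfl
      exacts [.inr ⟨_, rfl⟩, .inr ⟨_, rfl⟩]
    | update c j k p v =>
      simp only [Rule.body, Rule.head, List.cons_append, List.mem_append, List.mem_cons,
        List.not_mem_nil, or_false] at hα
      rcases hα with rfl | hα | rfl
      · exact .inr ⟨_, rfl⟩
      · split_ifs at hα
        · obtain rfl := List.mem_singleton.1 hα
          exact .inr ⟨_, rfl⟩
        · simp at hα
      · exact .inr ⟨_, rfl⟩
  · rintro (rfl | ⟨p, rfl⟩)
    · exact ⟨.start, rootAtom .x .z .o, by simp [Rule.body], rfl⟩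
    · cases p with
      | bit v j =>
        cases v with
        | false => exact ⟨.branch false j, _, List.mem_append_left _ List.mem_cons_self, rfl⟩
        | true =>
          -- With equal blocks and addresses the bit written is the incremented one, hence 1.
          refine ⟨.update false j j .eq true, _, List.mem_append_right _ List.mem_cons_self, ?_⟩
          simp [Pat.isBelow, Pat.isSame, cell]
      | edge c j => exact ⟨.branch c j, _, List.mem_append_right _ List.mem_cons_self, rfl⟩
      | pad k =>
        exact ⟨.start, _, List.mem_append_right _ (List.mem_cons_of_mem _
          (List.mem_map.2 ⟨k, List.mem_finRange k, rfl⟩)), rfl⟩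

/-- There are `2 * (N + 1)` bit and `2 * (N + 1)` edge symbols, three pads and the root predicate.
The pads serve only to make the total `4 * (N + 2)`, which is `4 * (n + 3)` for `N = n + 1`. -/
theorem ncard_sch_counterTGDs (N m : ℕ) : (sch (counterTGDs N m)).ncard = 4 * N + 8 := by
  have hne : rootPred ∉ Set.range (Sym.toPred (N := N) m) := by
    rintro ⟨p, hp⟩
    exact p.toPred_ne_rootPred hp
  rw [sch_counterTGDs, Set.ncard_insert_of_notMem hne (Set.finite_range _),
    ← Set.image_univ, Set.ncard_image_of_injective _ Sym.toPred_injective, Set.ncard_univ,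
    Sym.card]

theorem maxArity_counterTGDs (N m : ℕ) : maxArity (counterTGDs N m) = 2 * m + 4 := by
  have h : IsGreatest (Pred.arity '' sch (counterTGDs N m)) (2 * m + 4) := by
    rw [sch_counterTGDs]
    constructor
    · exact ⟨(Sym.pad 0 : Sym N).toPred m, Set.mem_insert_of_mem _ ⟨_, rfl⟩, rfl⟩
    · rintro _ ⟨R, rfl | ⟨p, rfl⟩, rfl⟩
      · change 3 ≤ 2 * m + 4
        omega
      · exact le_rfl
  exact h.csSup_eq

/-! ### Positions and addresses -/

/-- The bit positions of a node: a block and an address, ordered lexicographically. -/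
abbrev Pos (N m : ℕ) : Type := Fin (N + 1) ×ₗ Lex (Fin m → Bool)

/-- The position with the given block and address. -/
def pos {N m : ℕ} (j : Fin (N + 1)) (a : Fin m → Bool) : Pos N m := toLex (j, toLex a)

theorem pos_inj {N m : ℕ} {j k : Fin (N + 1)} {a b : Fin m → Bool} :
    pos j a = pos k b ↔ j = k ∧ a = b := by
  simp [pos]

theorem Pos.exists_eq_pos {N m : ℕ} (q : Pos N m) : ∃ j a, q = pos j a :=
  ⟨(ofLex q).1, ofLex (ofLex q).2, rfl⟩

theorem pos_lt_pos {N m : ℕ} {j k : Fin (N + 1)} {a b : Fin m → Bool} :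
    pos j a < pos k b ↔ j < k ∨ j = k ∧ toLex a < toLex b :=
  Prod.Lex.toLex_lt_toLex

/-- Two addresses compare as the pattern says. -/
def Pat.Compares {m : ℕ} (a b : Fin m → Bool) : Pat m → Prop
  | .eq => a = b
  | .lt i => (∀ k < i, a k = b k) ∧ a i = false ∧ b i = true
  | .gt i => (∀ k < i, a k = b k) ∧ a i = true ∧ b i = false

/-- Ensures that some `update` rule fits any pair of addresses. -/
theorem Pat.exists_compares {m : ℕ} (a b : Fin m → Bool) : ∃ p : Pat m, p.Compares a b := by
  rcases lt_trichotomy (toLex a) (toLex b) with ⟨i, h, hi⟩ | h | ⟨i, h, hi⟩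
  · exact ⟨.lt i, h, Bool.lt_iff.1 hi⟩
  · exact ⟨.eq, h⟩
  · exact ⟨.gt i, fun k hk => (h k hk).symm, (Bool.lt_iff.1 hi).symm⟩

theorem Pat.Compares.isBelow_iff {N m : ℕ} {a b : Fin m → Bool} {p : Pat m} (h : p.Compares a b)
    (j k : Fin (N + 1)) : p.isBelow j k = true ↔ pos j a < pos k b := by
  rw [pos_lt_pos]
  cases p with
  | eq =>
    obtain rfl : a = b := h
    simp only [Pat.isBelow, decide_eq_true_eq]
    exact (or_iff_left fun hc => lt_irrefl _ hc.2).symm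
  | lt i =>
    have hlt : toLex a < toLex b := ⟨i, h.1, Bool.lt_iff.2 h.2⟩
    simp [Pat.isBelow, hlt, le_iff_lt_or_eq]
  | gt i =>
    have hlt : toLex b < toLex a := ⟨i, fun k hk => (h.1 k hk).symm, Bool.lt_iff.2 h.2.symm⟩
    simp only [Pat.isBelow, decide_eq_true_eq]
    exact (or_iff_left fun hc => hlt.not_gt hc.2).symm

theorem Pat.Compares.isSame_eq {N m : ℕ} {a b : Fin m → Bool} {p : Pat m} (h : p.Compares a b)
    (j k : Fin (N + 1)) [Decidable (pos k b = pos j a)] :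
    p.isSame j k = decide (pos k b = pos j a) := by
  cases p with
  | eq => simp [Pat.isSame, pos_inj, show a = b from h, eq_comm]
  | lt i =>
    have hne : b ≠ a := by rintro rfl; simp [Pat.Compares] at h
    simp [Pat.isSame, pos_inj, hne]
  | gt i =>
    have hne : b ≠ a := by rintro rfl; simp [Pat.Compares] at h
    simp [Pat.isSame, pos_inj, hne]

theorem carryAt_eq {P : Type} [LinearOrder P] (s : P → Bool) (p q : P) :
    carryAt s p q = if p < q then s q else decide (q = p) := by
  rcases lt_trichotomy p q with h | rfl | h
  · simp [carryAt, h, h.not_gt, h.ne']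
  · simp [carryAt]
  · simp [carryAt, h, h.not_gt, h.ne]

/-- The constant for a bit. -/
def bitTerm (v : Bool) : Term := .const v.toNat

theorem bitTerm_injective : Function.Injective bitTerm := by
  intro v w h
  have := Term.const.inj h
  revert this
  cases v <;> cases w <;> simp

/-- The `i`-th root. -/
def rootTerm (i : ℕ) : Term := .const (i + 2)

theorem rootTerm_injective : Function.Injective rootTerm := fun _ _ h =>
  Nat.add_right_cancel (Term.const.inj h)

/-- The argument tuple with nodes `t` and `y` and addresses `a` and `b`. -/
def bitVec {m : ℕ} (t y : Term) (a b : Fin m → Bool) : LVar m → Term :=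
  vec t y (bitTerm false) (bitTerm true) (bitTerm ∘ a) (bitTerm ∘ b)

theorem bitVec_inj {m : ℕ} {t y t' y' : Term} {a b a' b' : Fin m → Bool} :
    bitVec t y a b = bitVec t' y' a' b' ↔ t = t' ∧ y = y' ∧ a = a' ∧ b = b' := by
  simp [bitVec, vec_inj, bitTerm_injective.comp_left.eq_iff]

/-- Soundness of the patterns: shared variables force a common prefix, and `z`, `o` force the first
difference. -/
theorem Pat.compares_of_comp_eq {m : ℕ} {p : Pat m} {a b : Fin m → Bool} {env : LVar m → Term}
    (hz : env .z = bitTerm false) (ho : env .o = bitTerm true)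
    (ha : env ∘ p.fst = bitTerm ∘ a) (hb : env ∘ p.snd = bitTerm ∘ b) : p.Compares a b := by
  have ha' := congrFun ha
  have hb' := congrFun hb
  cases p with
  | eq => exact bitTerm_injective.comp_left (ha.symm.trans hb)
  | lt i =>
    refine ⟨fun k hk => bitTerm_injective ?_, bitTerm_injective ?_, bitTerm_injective ?_⟩
    · have h1 := ha' k
      have h2 := hb' k
      simp only [Function.comp_apply, Pat.fst, Pat.snd, hk, hk.ne, if_false, if_true] at h1 h2
      exact h1.symm.trans h2
    · simpa [Pat.fst, hz] using (ha' i).symm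
    · simpa [Pat.snd, ho] using (hb' i).symm
  | gt i =>
    refine ⟨fun k hk => bitTerm_injective ?_, bitTerm_injective ?_, bitTerm_injective ?_⟩
    · have h1 := ha' k
      have h2 := hb' k
      simp only [Function.comp_apply, Pat.fst, Pat.snd, hk, hk.ne, if_false, if_true] at h1 h2
      exact h1.symm.trans h2
    · simpa [Pat.fst, ho] using (ha' i).symm
    · simpa [Pat.snd, hz] using (hb' i).symm

theorem Pat.Compares.bitVec_comp_fst {m : ℕ} {p : Pat m} {a b : Fin m → Bool}
    (h : p.Compares a b) (t y : Term) : bitVec t y a b ∘ p.fst = bitTerm ∘ a := by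
  funext k
  cases p with
  | eq => rfl
  | lt i =>
    by_cases hk : k = i
    · subst hk
      simp [Pat.fst, bitVec, vec, h.2.1]
    · simp [Pat.fst, bitVec, vec, hk]
  | gt i =>
    by_cases hk : k = i
    · subst hk
      simp [Pat.fst, bitVec, vec, h.2.1]
    · simp [Pat.fst, bitVec, vec, hk]

theorem Pat.Compares.bitVec_comp_snd {m : ℕ} {p : Pat m} {a b : Fin m → Bool}
    (h : p.Compares a b) (t y : Term) : bitVec t y a b ∘ p.snd = bitTerm ∘ b := by
  funext k
  cases p with
  | eq => rw [show a = b from h]; rfl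
  | lt i =>
    rcases lt_trichotomy k i with hk | rfl | hk
    · simp [Pat.snd, bitVec, vec, hk, h.1 k hk]
    · simp [Pat.snd, bitVec, vec, h.2.2]
    · simp [Pat.snd, bitVec, vec, hk.not_gt, hk.ne']
  | gt i =>
    rcases lt_trichotomy k i with hk | rfl | hk
    · simp [Pat.snd, bitVec, vec, hk, h.1 k hk]
    · simp [Pat.snd, bitVec, vec, h.2.2]
    · simp [Pat.snd, bitVec, vec, hk.not_gt, hk.ne']

/-! ### Nodes -/

/-- The `c`-th child of the node `t` which increments the bit at `p`. -/
noncomputable def child {N m : ℕ} (c : Bool) (p : Pos N m) (t : Term) : Term :=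
  Term.null (Rule.branch c (ofLex p).1 : Rule N m).tgd
    (fun w => bitVec t t (ofLex (ofLex p).2) (ofLex (ofLex p).2) (varDecode N w))
    (varCode ((.branch c (ofLex p).1 : Rule N m), .y))

theorem occurs_singleton_cell {N m : ℕ} {V : Type} {p : Sym N} {f : LVar m → V} {v : V} :
    v ∈ occurs [cell p f] ↔ v ∈ Set.range f := by
  simp [occurs, Atom.terms_cell]

theorem Rule.mem_occurs_branch_body {N m : ℕ} {c : Bool} {j : Fin (N + 1)} {v : LVar m} :
    v ∈ occurs (Rule.branch c j : Rule N m).body ↔ v ≠ .y ∧ ∀ i, v ≠ .b i := by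
  rw [Rule.body, occurs_singleton_cell]
  constructor
  · rintro ⟨u, rfl⟩
    cases u <;> simp [vec]
  · rintro ⟨h1, h2⟩
    cases v with
    | x => exact ⟨.x, rfl⟩
    | y => exact absurd rfl h1
    | z => exact ⟨.z, rfl⟩
    | o => exact ⟨.o, rfl⟩
    | a i => exact ⟨.a i, rfl⟩
    | b i => exact absurd rfl (h2 i)

theorem Rule.mem_frontier_branch {N m : ℕ} {c : Bool} {j : Fin (N + 1)} {v : LVar m}
    (h1 : v ≠ .y) (h2 : ∀ i, v ≠ .b i) :
    varCode ((.branch c j : Rule N m), v) ∈ (Rule.branch c j : Rule N m).tgd.frontier := by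
  rw [Rule.varCode_mem_frontier_tgd, Rule.mem_occurs_branch_body, Rule.head, occurs_singleton_cell]
  refine ⟨⟨h1, h2⟩, ?_⟩
  cases v with
  | x => exact ⟨.x, rfl⟩
  | y => exact absurd rfl h1
  | z => exact ⟨.z, rfl⟩
  | o => exact ⟨.o, rfl⟩
  | a i => exact ⟨.a i, rfl⟩
  | b i => exact absurd rfl (h2 i)

theorem child_inj {N m : ℕ} {c c' : Bool} {p p' : Pos N m} {t t' : Term}
    (h : child c p t = child c' p' t') : c = c' ∧ p = p' ∧ t = t' := by
  obtain ⟨j, a, rfl⟩ := p.exists_eq_pos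
  obtain ⟨j', a', rfl⟩ := p'.exists_eq_pos
  -- The rule is read off the code of its variable `y`, so injectivity of `Rule.tgd` is not needed.
  -- Once the rules agree, so do the frontiers, and the assignments on them give the parent and the
  -- address.
  have h3 := (Term.null.inj h).2.2
  have h4 := (Prod.ext_iff.1 (varCode_injective h3)).1
  simp only [pos, ofLex_toLex] at h4
  obtain ⟨rfl, rfl⟩ := Rule.branch.inj h4
  have h2 := congrFun (eq_of_heq (Term.null.inj h).2.1)
  have hx := h2 ⟨_, Rule.mem_frontier_branch (v := .x) (by simp) (by simp)⟩
  have ha : a = a' := by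
    funext i
    have := h2 ⟨_, Rule.mem_frontier_branch (v := .a i) (by simp) (by simp)⟩
    simp only [pos, ofLex_toLex, varDecode_varCode] at this
    exact bitTerm_injective this
  subst ha
  simp only [varDecode_varCode] at hx
  exact ⟨rfl, rfl, hx⟩

/-- The name of the null sees `env` only on the frontier, which excludes `y` and the second address.
-/
theorem Rule.extend_branch_y {N m : ℕ} {c : Bool} {j : Fin (N + 1)} {env : LVar m → Term}
    {t : Term} {a : Fin m → Bool} (hx : env .x = t) (hz : env .z = bitTerm false)
    (ho : env .o = bitTerm true) (ha : env ∘ .a = bitTerm ∘ a) :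
    (Rule.branch c j : Rule N m).extend env .y = child c (pos j a) t := by
  rw [Rule.extend, if_neg (by simp [Rule.mem_occurs_branch_body]), child]
  congr 1
  funext ⟨w, hw⟩
  change env (varDecode N w) = bitVec t t a a (varDecode N w)
  rw [Rule.frontier_tgd] at hw
  obtain ⟨u, ⟨hu, -⟩, rfl⟩ := hw
  rw [Rule.mem_occurs_branch_body] at hu
  simp only [varDecode_varCode]
  cases u with
  | x => exact hx
  | y => exact absurd rfl hu.1
  | z => exact hz
  | o => exact ho
  | a i => exact congrFun ha i
  | b i => exact absurd rfl (hu.2 i)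

/-! ### Head atoms under the extended assignment. -/

theorem Rule.extend_of_mem {N m : ℕ} {r : Rule N m} {env : LVar m → Term} {v : LVar m}
    (hv : v ∈ occurs r.body) : r.extend env v = env v := if_pos hv

theorem Rule.map_extend_branch {N m : ℕ} {c : Bool} {j : Fin (N + 1)} {env : LVar m → Term}
    {t : Term} {a : Fin m → Bool} (hx : env .x = t) (hz : env .z = bitTerm false)
    (ho : env .o = bitTerm true) (ha : env ∘ .a = bitTerm ∘ a) :
    (cell (.edge c j : Sym N) (vec .x .y .z .o .a fun _ => .z)).map
        ((Rule.branch c j : Rule N m).extend env) =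
      cell (.edge c j) (bitVec t (child c (pos j a) t) a fun _ => false) := by
  have hx' : (Rule.branch c j : Rule N m).extend env .x = t :=
    (Rule.extend_of_mem (by simp [Rule.mem_occurs_branch_body])).trans hx
  have hz' : (Rule.branch c j : Rule N m).extend env .z = bitTerm false :=
    (Rule.extend_of_mem (by simp [Rule.mem_occurs_branch_body])).trans hz
  have ho' : (Rule.branch c j : Rule N m).extend env .o = bitTerm true :=
    (Rule.extend_of_mem (by simp [Rule.mem_occurs_branch_body])).trans ho
  have ha' : (Rule.branch c j : Rule N m).extend env ∘ .a = bitTerm ∘ a := by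
    rw [← ha]
    funext i
    exact Rule.extend_of_mem (by simp [Rule.mem_occurs_branch_body])
  rw [Atom.map_cell, comp_vec, hx', hz', ho', ha', Rule.extend_branch_y hx hz ho ha, bitVec]
  congr 2
  funext i
  exact hz'

theorem Rule.map_extend_of_subset {N m : ℕ} {r : Rule N m} {env : LVar m → Term}
    {α : Atom (LVar m)} (h : α.terms ⊆ occurs r.body) : α.map (r.extend env) = α.map env :=
  Atom.map_congr fun _ hv => Rule.extend_of_mem (h hv)

theorem Rule.terms_head_start_subset {N m : ℕ} {p : Sym N} :
    (cell p (vec (m := m) .x .x .z .o (fun _ => .o) fun _ => .z)).terms ⊆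
      occurs (Rule.start : Rule N m).body := by
  rw [Atom.terms_cell]
  rintro _ ⟨u, rfl⟩
  refine ⟨_, List.mem_singleton_self _, Atom.mem_terms_rootAtom.2 ?_⟩
  cases u <;> simp [vec]

theorem Rule.terms_head_flip_subset {N m : ℕ} {c : Bool} {j : Fin (N + 1)} {i : Fin m} {p : Sym N} :
    (cell p (vec .x .y .z .o .a (Function.update .b i .o))).terms ⊆
      occurs (Rule.flip c j i : Rule N m).body := by
  rw [Atom.terms_cell, Rule.body]
  rintro _ ⟨u, rfl⟩
  rw [occurs_singleton_cell]
  cases u with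
  | x => exact ⟨.x, rfl⟩
  | y => exact ⟨.y, rfl⟩
  | z => exact ⟨.z, rfl⟩
  | o => exact ⟨.o, rfl⟩
  | a k => exact ⟨.a k, rfl⟩
  | b k =>
    by_cases hk : k = i
    · subst hk
      exact ⟨.o, by simp [vec]⟩
    · exact ⟨.b k, by simp [vec, hk]⟩

theorem Rule.terms_head_update_subset {N m : ℕ} {c : Bool} {j k : Fin (N + 1)} {p : Pat m}
    {v : Bool} {q : Sym N} :
    (cell q (vec .y .y .z .o p.snd p.snd)).terms ⊆
      occurs (Rule.update c j k p v : Rule N m).body := by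
  rw [Atom.terms_cell, Rule.body]
  rintro _ ⟨u, rfl⟩
  refine ⟨_, List.mem_cons_self, ?_⟩
  rw [Atom.terms_cell]
  cases u with
  | x => exact ⟨.y, rfl⟩
  | y => exact ⟨.y, rfl⟩
  | z => exact ⟨.z, rfl⟩
  | o => exact ⟨.o, rfl⟩
  | a k => exact ⟨.b k, rfl⟩
  | b k => exact ⟨.b k, rfl⟩

/-! ### A finite closed instance -/

/-- The most significant position. -/
def maxPos (N m : ℕ) : Pos N m := pos (Fin.last N) fun _ => true

theorem not_maxPos_lt {N m : ℕ} (q : Pos N m) : ¬ maxPos N m < q := by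
  obtain ⟨j, a, rfl⟩ := q.exists_eq_pos
  rw [maxPos, pos_lt_pos]
  rintro (h | ⟨-, i, -, h⟩)
  · exact h.not_ge (Fin.le_last _)
  · exact absurd (Bool.lt_iff.1 h).1 (by simp)

/-- The counter of the roots. -/
noncomputable def rootState (N m : ℕ) : Pos N m → Bool := carryAt (fun _ => false) (maxPos N m)

/-- The nodes that grow from the first `ℓ` roots, with their counters. -/
inductive IsNode {N m : ℕ} (ℓ : ℕ) : Term → (Pos N m → Bool) → Prop
  | root (i : ℕ) (hi : i < ℓ) : IsNode ℓ (rootTerm i) (rootState N m)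
  | child (c : Bool) (p : Pos N m) (t : Term) (s : Pos N m → Bool) (ht : IsNode ℓ t s)
      (hs : s p = false) : IsNode ℓ (child c p t) (carryAt s p)

/-- The edges between the nodes, with the counter of the target. Roots have loops. -/
inductive IsEdge {N m : ℕ} (ℓ : ℕ) : Bool → Pos N m → Term → Term → (Pos N m → Bool) → Prop
  | root (i : ℕ) (hi : i < ℓ) :
      IsEdge ℓ false (maxPos N m) (rootTerm i) (rootTerm i) (rootState N m)
  | child (c : Bool) (p : Pos N m) (t : Term) (s : Pos N m → Bool) (ht : IsNode ℓ t s)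
      (hs : s p = false) : IsEdge ℓ c p t (child c p t) (carryAt s p)

/-- The name of a node records its whole history. Uniqueness is needed because `update` reads the
parent's bit from an atom tied to the edge only through the node and the address. -/
theorem IsNode.state_unique {N m ℓ : ℕ} {t : Term} {s s' : Pos N m → Bool} (h : IsNode ℓ t s)
    (h' : IsNode ℓ t s') : s = s' := by
  induction h generalizing s' with
  | root i hi =>
    generalize ht : rootTerm i = t at h'
    cases h' with
    | root => rfl
    | child => simp [rootTerm, SOChase.child] at ht
  | child c p t s _ _ ih =>
    generalize ht : SOChase.child c p t = u at h'
    cases h' with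
    | root => simp [rootTerm, SOChase.child] at ht
    | child c' p' t' s' hn =>
      obtain ⟨rfl, rfl, rfl⟩ := child_inj ht
      rw [ih hn]

theorem IsEdge.isNode_target {N m ℓ : ℕ} {c : Bool} {p : Pos N m} {t y : Term}
    {s : Pos N m → Bool} (h : IsEdge ℓ c p t y s) : IsNode ℓ y s := by
  cases h with
  | root i hi => exact .root i hi
  | child _ _ _ s ht hs => exact .child c p t s ht hs

theorem IsEdge.exists_isNode_source {N m ℓ : ℕ} {c : Bool} {p : Pos N m} {t y : Term}
    {s : Pos N m → Bool} (h : IsEdge ℓ c p t y s) : ∃ s' : Pos N m → Bool, IsNode ℓ t s' := by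
  cases h with
  | root i hi => exact ⟨_, .root i hi⟩
  | child _ _ _ s ht hs => exact ⟨s, ht⟩

theorem IsEdge.apply_of_not_lt {N m ℓ : ℕ} {c : Bool} {p q : Pos N m} {t y : Term}
    {s : Pos N m → Bool} [Decidable (q = p)] (h : IsEdge ℓ c p t y s) (hq : ¬ p < q) :
    s q = decide (q = p) := by
  cases h with
  | root =>
    rw [rootState, carryAt_eq, if_neg hq]
    exact decide_eq_decide.2 Iff.rfl
  | child =>
    rw [carryAt_eq, if_neg hq]
    exact decide_eq_decide.2 Iff.rfl

/-- Vacuous for the loops at the roots, since nothing lies above `maxPos`. -/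
theorem IsEdge.apply_of_lt {N m ℓ : ℕ} {c : Bool} {p q : Pos N m} {t y : Term}
    {s s' : Pos N m → Bool} (h : IsEdge ℓ c p t y s) (hq : p < q) (ht : IsNode ℓ t s') :
    s q = s' q := by
  cases h with
  | root => exact absurd hq (not_maxPos_lt q)
  | child _ _ _ s hs => rw [carryAt_eq, if_pos hq, hs.state_unique ht]

/-- A node with counter `s` is a root or a child of a node with a smaller counter, and there are
finitely many counters, positions and choices. -/
theorem finite_isNode_state {N m ℓ : ℕ} (s : Pos N m → Bool) : {t | IsNode ℓ t s}.Finite := by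
  refine wellFounded_counterLT.induction (C := fun s => {t | IsNode ℓ t s}.Finite) s fun s ih => ?_
  have hfin : (rootTerm '' Set.Iio ℓ ∪ ⋃ s' : Pos N m → Bool, ⋃ _ : CounterLT s' s,
      ⋃ c : Bool, ⋃ p : Pos N m, child c p '' {t | IsNode ℓ t s'}).Finite := by
    refine ((Set.finite_Iio ℓ).image _).union (Set.finite_iUnion fun s' => ?_)
    refine Set.finite_iUnion fun hs' => ?_
    exact Set.finite_iUnion fun c => Set.finite_iUnion fun p => (ih s' hs').image _
  refine hfin.subset fun t ht => ?_
  cases ht with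
  | root i hi => exact .inl ⟨i, hi, rfl⟩
  | child c p t s' ht hs =>
    refine .inr ?_
    simp only [Set.mem_iUnion]
    exact ⟨s', counterLT_carryAt hs, c, p, t, ht, rfl⟩

/-- The set of nodes. -/
def nodes (N m ℓ : ℕ) : Set Term := ⋃ s : Pos N m → Bool, {t | IsNode ℓ t s}

theorem finite_nodes (N m ℓ : ℕ) : (nodes N m ℓ).Finite := Set.finite_iUnion finite_isNode_state

theorem IsNode.mem_nodes {N m ℓ : ℕ} {t : Term} {s : Pos N m → Bool} (h : IsNode ℓ t s) :
    t ∈ nodes N m ℓ := Set.mem_iUnion.2 ⟨s, h⟩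

/-- The instance that describes the nodes, their edges and their counters. -/
def counterModel (N m ℓ : ℕ) : Instance :=
  {α | (∃ i < ℓ, α = rootAtom (rootTerm i) (bitTerm false) (bitTerm true)) ∨
    (∃ i < ℓ, ∃ k, α = cell (.pad k : Sym N) (bitVec (m := m) (rootTerm i) (rootTerm i)
      (fun _ => true) fun _ => false)) ∨
    (∃ c j a b t y s, IsEdge (N := N) (m := m) ℓ c (pos j a) t y s ∧
      α = cell (.edge c j : Sym N) (bitVec t y a b)) ∨
    ∃ j b t s, IsNode (N := N) (m := m) ℓ t s ∧
      α = cell (.bit (s (pos j b)) j : Sym N) (bitVec t t b b)}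

theorem finite_counterModel (N m ℓ : ℕ) : (counterModel N m ℓ).Finite := by
  have h1 : ((fun i => rootAtom (rootTerm i) (bitTerm false) (bitTerm true)) ''
    Set.Iio ℓ).Finite := (Set.finite_Iio ℓ).image _
  have h2 : ((fun x : Sym N × Term × Term × (Fin m → Bool) × (Fin m → Bool) =>
      cell x.1 (bitVec x.2.1 x.2.2.1 x.2.2.2.1 x.2.2.2.2)) ''
      (Set.univ ×ˢ nodes N m ℓ ×ˢ nodes N m ℓ ×ˢ Set.univ ×ˢ Set.univ)).Finite :=
    (Set.finite_univ.prod ((finite_nodes N m ℓ).prod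
      ((finite_nodes N m ℓ).prod (Set.finite_univ.prod Set.finite_univ)))).image _
  refine (h1.union h2).subset ?_
  rintro α (⟨i, hi, rfl⟩ | ⟨i, hi, k, rfl⟩ | ⟨c, j, a, b, t, y, s, h, rfl⟩ |
    ⟨j, b, t, s, h, rfl⟩)
  · exact .inl ⟨i, hi, rfl⟩
  · have hn := (IsNode.root (N := N) (m := m) i hi).mem_nodes
    exact .inr ⟨⟨_, _, _, _, _⟩, ⟨trivial, hn, hn, trivial, trivial⟩, rfl⟩
  · obtain ⟨s', hs'⟩ := h.exists_isNode_source
    exact .inr ⟨⟨_, _, _, _, _⟩,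
      ⟨trivial, hs'.mem_nodes, h.isNode_target.mem_nodes, trivial, trivial⟩, rfl⟩
  · exact .inr ⟨⟨_, _, _, _, _⟩, ⟨trivial, h.mem_nodes, h.mem_nodes, trivial, trivial⟩, rfl⟩

theorem rootAtom_mem_counterModel {N m ℓ : ℕ} {x z o : Term} :
    rootAtom x z o ∈ counterModel N m ℓ ↔
      ∃ i < ℓ, x = rootTerm i ∧ z = bitTerm false ∧ o = bitTerm true := by
  constructor
  · rintro (⟨i, hi, h⟩ | ⟨i, hi, k, h⟩ | ⟨c, j, a, b, t, y, s, -, h⟩ | ⟨j, b, t, s, -, h⟩)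
    · exact ⟨i, hi, rootAtom_inj.1 h⟩
    all_goals exact absurd h.symm (cell_ne_rootAtom _ _ _ _ _)
  · rintro ⟨i, hi, rfl, rfl, rfl⟩
    exact .inl ⟨i, hi, rfl⟩

theorem edge_mem_counterModel {N m ℓ : ℕ} {c : Bool} {j : Fin (N + 1)} {f : LVar m → Term} :
    cell (.edge c j : Sym N) f ∈ counterModel N m ℓ ↔
      ∃ a b t y s, IsEdge (N := N) ℓ c (pos j a) t y s ∧ f = bitVec t y a b := by
  constructor
  · rintro (⟨i, hi, h⟩ | ⟨i, hi, k, h⟩ | ⟨c, j, a, b, t, y, s, hs, h⟩ | ⟨j, b, t, s, -, h⟩)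
    · exact absurd h (cell_ne_rootAtom _ _ _ _ _)
    · exact absurd (cell_inj.1 h).1 (by simp)
    · obtain ⟨h1, rfl⟩ := cell_inj.1 h
      obtain ⟨rfl, rfl⟩ := Sym.edge.inj h1
      exact ⟨a, b, t, y, s, hs, rfl⟩
    · exact absurd (cell_inj.1 h).1 (by simp)
  · rintro ⟨a, b, t, y, s, h, rfl⟩
    exact .inr (.inr (.inl ⟨c, j, a, b, t, y, s, h, rfl⟩))

theorem bit_mem_counterModel {N m ℓ : ℕ} {v : Bool} {j : Fin (N + 1)} {f : LVar m → Term} :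
    cell (.bit v j : Sym N) f ∈ counterModel N m ℓ ↔
      ∃ b t s, IsNode (N := N) ℓ t s ∧ s (pos j b) = v ∧ f = bitVec t t b b := by
  constructor
  · rintro (⟨i, hi, h⟩ | ⟨i, hi, k, h⟩ | ⟨c, j, a, b, t, y, s, -, h⟩ | ⟨j, b, t, s, hs, h⟩)
    · exact absurd h (cell_ne_rootAtom _ _ _ _ _)
    · exact absurd (cell_inj.1 h).1 (by simp)
    · exact absurd (cell_inj.1 h).1 (by simp)
    · obtain ⟨h1, rfl⟩ := cell_inj.1 h
      obtain ⟨rfl, rfl⟩ := Sym.bit.inj h1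
      exact ⟨b, t, s, hs, rfl, rfl⟩
  · rintro ⟨b, t, s, h, rfl, rfl⟩
    exact .inr (.inr (.inr ⟨j, b, t, s, h, rfl⟩))

theorem isClosedUnder_counterModel (N m ℓ : ℕ) :
    IsClosedUnder (counterTGDs N m) (counterModel N m ℓ) := by
  rw [isClosedUnder_counterTGDs]
  intro r env hb α hα
  cases r with
  | start =>
    have h := hb _ List.mem_cons_self
    rw [Atom.map_rootAtom, rootAtom_mem_counterModel] at h
    obtain ⟨i, hi, hx, hz, ho⟩ := h
    have hvec : env ∘ vec (m := m) .x .x .z .o (fun _ => .o) (fun _ => .z) =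
        bitVec (rootTerm i) (rootTerm i) (fun _ => true) fun _ => false := by
      rw [comp_vec, bitVec, vec_inj]
      exact ⟨hx, hx, hz, ho, funext fun _ => ho, funext fun _ => hz⟩
    simp only [Rule.head, List.mem_cons, List.mem_map] at hα
    rcases hα with rfl | ⟨k, -, rfl⟩
    · rw [Rule.map_extend_of_subset Rule.terms_head_start_subset, Atom.map_cell, hvec,
        edge_mem_counterModel]
      exact ⟨_, _, _, _, _, .root i hi, rfl⟩
    · rw [Rule.map_extend_of_subset Rule.terms_head_start_subset, Atom.map_cell, hvec]
      exact .inr (.inl ⟨i, hi, k, rfl⟩)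
  | branch c j =>
    have h := hb _ List.mem_cons_self
    rw [Atom.map_cell, bit_mem_counterModel] at h
    obtain ⟨b, t, s, hn, hs, h⟩ := h
    rw [comp_vec, bitVec, vec_inj] at h
    obtain ⟨hx, -, hz, ho, ha, -⟩ := h
    obtain rfl := List.mem_singleton.1 hα
    rw [Rule.map_extend_branch hx hz ho ha, edge_mem_counterModel]
    exact ⟨_, _, _, _, _, .child c _ t s hn hs, rfl⟩
  | flip c j i =>
    have h := hb _ List.mem_cons_self
    rw [Atom.map_cell, edge_mem_counterModel] at h
    obtain ⟨a, b, t, y, s, he, h⟩ := h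
    rw [comp_vec, bitVec, vec_inj, Function.comp_update] at h
    obtain ⟨hx, hy, hz, ho, ha, hb⟩ := h
    obtain rfl := List.mem_singleton.1 hα
    rw [Rule.map_extend_of_subset Rule.terms_head_flip_subset, Atom.map_cell,
      edge_mem_counterModel]
    refine ⟨a, Function.update b i true, t, y, s, he, ?_⟩
    rw [comp_vec, bitVec, vec_inj, Function.comp_update, Function.comp_update, ← hb,
      Function.update_idem]
    exact ⟨hx, hy, hz, ho, ha, by rw [ho]⟩
  | update c j k p v =>
    have h := hb _ List.mem_cons_self
    rw [Atom.map_cell, edge_mem_counterModel] at h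
    obtain ⟨a, b, t, y, s, he, h⟩ := h
    rw [comp_vec, bitVec, vec_inj] at h
    obtain ⟨hx, hy, hz, ho, hfst, hsnd⟩ := h
    have hcmp := Pat.compares_of_comp_eq hz ho hfst hsnd
    obtain rfl := List.mem_singleton.1 hα
    rw [Rule.map_extend_of_subset Rule.terms_head_update_subset, Atom.map_cell,
      bit_mem_counterModel]
    refine ⟨b, y, s, he.isNode_target, ?_, ?_⟩
    -- Above the increment the bit is copied from the parent, whose counter is unique; elsewhere the
    -- pattern alone decides it.
    · by_cases hlt : pos j a < pos k b
      · have hbelow := (hcmp.isBelow_iff j k).2 hlt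
        have h := hb (cell (.bit v k) (vec .x .x .z .o p.snd p.snd))
          (List.mem_cons_of_mem _ (by simp [hbelow]))
        rw [Atom.map_cell, bit_mem_counterModel] at h
        obtain ⟨b', t', s', hn, hs, h⟩ := h
        rw [comp_vec, bitVec, vec_inj] at h
        obtain rfl := bitTerm_injective.comp_left (hsnd.symm.trans h.2.2.2.2.1)
        obtain rfl := hx.symm.trans h.1
        rw [if_pos hbelow, he.apply_of_lt hlt hn, hs]
      · rw [if_neg (fun hc => hlt ((hcmp.isBelow_iff j k).1 hc)), he.apply_of_not_lt hlt,
          hcmp.isSame_eq]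
    · rw [comp_vec, bitVec, vec_inj]
      exact ⟨hy, hy, hz, ho, hsnd, hsnd⟩

/-! ### The lower bound -/

/-- The counter `s` is stored at `t`. -/
def Stores {N m : ℕ} (J : Instance) (t : Term) (s : Pos N m → Bool) : Prop :=
  ∀ j b, cell (.bit (s (pos j b)) j : Sym N) (bitVec t t b b) ∈ J

section Closed

variable {N m : ℕ} {J : Instance}

/-- Each use of `flip` turns one 0 of the second address into 1; the induction is on the set of
ones. -/
theorem IsClosedUnder.edge_mem (hJ : IsClosedUnder (counterTGDs N m) J) {c : Bool}
    {j : Fin (N + 1)} {t y : Term} {a : Fin m → Bool}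
    (h : cell (.edge c j : Sym N) (bitVec t y a fun _ => false) ∈ J) (b : Fin m → Bool) :
    cell (.edge c j : Sym N) (bitVec t y a b) ∈ J := by
  classical
  rw [isClosedUnder_counterTGDs] at hJ
  have key : ∀ F : Finset (Fin m),
      cell (.edge c j : Sym N) (bitVec t y a fun k => decide (k ∈ F)) ∈ J := by
    intro F
    induction F using Finset.induction_on with
    | empty => simpa using h
    | insert i F hi ih =>
      have h1 := hJ (.flip c j i) (bitVec t y a fun k => decide (k ∈ F)) (by
        intro α hα
        obtain rfl := List.mem_singleton.1 hα
        rw [Atom.map_cell, comp_vec, Function.comp_update]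
        convert ih using 2
        rw [bitVec, vec_inj]
        refine ⟨rfl, rfl, rfl, rfl, rfl, ?_⟩
        funext k
        by_cases hk : k = i
        · subst hk
          simp [vec, hi]
        · simp [vec, hk]) _ List.mem_cons_self
      rw [Rule.map_extend_of_subset Rule.terms_head_flip_subset, Atom.map_cell, comp_vec,
        Function.comp_update] at h1
      convert h1 using 2
      rw [bitVec, vec_inj]
      refine ⟨rfl, rfl, rfl, rfl, rfl, ?_⟩
      funext k
      by_cases hk : k = i
      · subst hk
        simp [bitVec, vec]
      · simp [bitVec, vec, hk]
  convert key (Finset.univ.filter fun k => b k = true) using 3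
  funext k
  simp

/-- Only the bits of `t` above the increment are assumed, so that the loop at a root, where there
are none, is covered too. -/
theorem IsClosedUnder.stores_of_edge (hJ : IsClosedUnder (counterTGDs N m) J) {c : Bool}
    {j : Fin (N + 1)} {t y : Term} {a : Fin m → Bool} {s : Pos N m → Bool}
    (h : cell (.edge c j : Sym N) (bitVec t y a fun _ => false) ∈ J)
    (hs : ∀ k b, pos j a < pos k b →
      cell (.bit (s (pos k b)) k : Sym N) (bitVec t t b b) ∈ J) :
    Stores J y (carryAt s (pos j a)) := by
  intro k b
  have he := hJ.edge_mem h b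
  rw [isClosedUnder_counterTGDs] at hJ
  obtain ⟨p, hp⟩ := Pat.exists_compares a b
  have h1 := hJ (.update c j k p (s (pos k b))) (bitVec t y a b) (by
    intro α hα
    rcases List.mem_cons.1 hα with rfl | hα
    · rw [Atom.map_cell, comp_vec, hp.bitVec_comp_fst, hp.bitVec_comp_snd]
      exact he
    · split_ifs at hα with hb
      · obtain rfl := List.mem_singleton.1 hα
        rw [Atom.map_cell, comp_vec, hp.bitVec_comp_snd]
        exact hs k b ((hp.isBelow_iff j k).1 hb)
      · simp at hα) _ List.mem_cons_self
  rw [Rule.map_extend_of_subset Rule.terms_head_update_subset, Atom.map_cell, comp_vec,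
    hp.bitVec_comp_snd] at h1
  rw [carryAt_eq, ← hp.isSame_eq]
  simp only [← hp.isBelow_iff]
  convert h1
  rfl

theorem IsClosedUnder.stores_child (hJ : IsClosedUnder (counterTGDs N m) J) {t : Term}
    {s : Pos N m → Bool} (ht : Stores J t s) (c : Bool) {p : Pos N m} (hp : s p = false) :
    Stores J (child c p t) (carryAt s p) := by
  obtain ⟨j, a, rfl⟩ := p.exists_eq_pos
  refine hJ.stores_of_edge (c := c) (t := t) ?_ fun k b _ => ht k b
  rw [isClosedUnder_counterTGDs] at hJ
  have h1 := hJ (.branch c j) (bitVec t t a a) (by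
    intro α hα
    obtain rfl := List.mem_singleton.1 hα
    have h := ht j a
    rw [hp] at h
    rw [Atom.map_cell, comp_vec]
    exact h) _ List.mem_cons_self
  rwa [Rule.map_extend_branch (t := t) (a := a) rfl rfl rfl rfl] at h1

theorem IsClosedUnder.stores_root (hJ : IsClosedUnder (counterTGDs N m) J) {i : ℕ}
    (h : rootAtom (rootTerm i) (bitTerm false) (bitTerm true) ∈ J) :
    Stores J (rootTerm i) (rootState N m) := by
  refine hJ.stores_of_edge (c := false) (t := rootTerm i) ?_
    fun k b hlt => absurd hlt (not_maxPos_lt _)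
  rw [isClosedUnder_counterTGDs] at hJ
  have h1 := hJ .start (bitVec (rootTerm i) (rootTerm i) (fun _ => true) fun _ => false) (by
    intro α hα
    obtain rfl := List.mem_singleton.1 hα
    rw [Atom.map_rootAtom]
    exact h) _ List.mem_cons_self
  rw [Rule.map_extend_of_subset Rule.terms_head_start_subset, Atom.map_cell, comp_vec] at h1
  exact h1

theorem IsClosedUnder.le_ncard (hJ : IsClosedUnder (counterTGDs N m) J) (hfin : J.Finite) {ℓ : ℕ}
    (h : ∀ i < ℓ, rootAtom (rootTerm i) (bitTerm false) (bitTerm true) ∈ J) :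
    ℓ * 2 ^ (2 ^ ((N + 1) * 2 ^ m - 1) - 1) ≤ J.ncard := by
  classical
  let _ : Fintype (Pos N m) := Fintype.ofFinite _
  have hcard : Fintype.card (Pos N m) = (N + 1) * 2 ^ m := by
    rw [← Nat.card_eq_fintype_card]
    change Nat.card (Fin (N + 1) × (Fin m → Bool)) = _
    simp
  let e := Fintype.orderIsoFinOfCardEq (Pos N m) hcard
  obtain ⟨A, hA, hst⟩ := exists_card_mul_two_pow_le e (Stores J) child
    (fun p c t c' t' h => ⟨(child_inj h).1, (child_inj h).2.2⟩)
    -- The root counters already have the top bit set, which leaves one position fewer to count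
    -- through.
    (fun t s p c ht hs => hJ.stores_child ht c hs) ((N + 1) * 2 ^ m - 1) (Nat.sub_le _ _)
    (rootState N m) (by
      intro i hi
      have hlt : e i < e ⟨i + 1, by omega⟩ := e.lt_iff_lt.2 (Fin.lt_def.2 (Nat.lt_succ_self _))
      have hne : e i ≠ maxPos N m := fun hc => not_maxPos_lt _ (hc ▸ hlt)
      simp [rootState, carryAt, hne])
    ((Finset.range ℓ).map ⟨rootTerm, rootTerm_injective⟩) (by
      intro t ht
      obtain ⟨i, hi, rfl⟩ := Finset.mem_map.1 ht
      exact hJ.stores_root (h i (Finset.mem_range.1 hi)))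
  rw [Finset.card_map, Finset.card_range] at hA
  refine hA.trans ?_
  rw [← Set.ncard_coe_finset A]
  -- All nodes of `A` store the same counter, so the atom for the top bit is an injective function
  -- of the node.
  refine Set.ncard_le_ncard_of_injOn _
    (fun t ht => hst t ht (Fin.last N) fun _ => true) ?_ hfin
  intro t _ t' _ htt
  exact (bitVec_inj.1 (cell_inj.1 htt).2).1

end Closed

/-! ### The databases and the final estimate. -/

/-- The database with `ℓ` roots. -/
def counterDB (ℓ : ℕ) : Database :=
  (Finset.range ℓ).map ⟨fun i => rootAtom (i + 2) 0 1, fun _ _ h =>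
    Nat.add_right_cancel (rootAtom_inj.1 h).1⟩

theorem mem_toInstance_counterDB {ℓ : ℕ} {α : Atom Term} :
    α ∈ (counterDB ℓ).toInstance ↔
      ∃ i < ℓ, rootAtom (rootTerm i) (bitTerm false) (bitTerm true) = α := by
  simp only [Database.toInstance, counterDB, Finset.coe_map, Finset.coe_range, Set.mem_image,
    exists_exists_and_eq_and, Set.mem_Iio]
  refine exists_congr fun i => and_congr_right fun _ => ?_
  change (rootAtom (i + 2) 0 1).map Term.const = α ↔ _
  rw [Atom.map_rootAtom]
  rfl

/-- The left side is `2 ^ (n + 2 ^ m) - 2 ^ n`, so it suffices to compare exponents and use `1 ≤ 2 ^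
n`. -/
theorem two_pow_mul_le (n m : ℕ) :
    2 ^ n * (2 ^ 2 ^ m - 1) ≤ 2 ^ ((n + 1 + 1) * 2 ^ m - 1) - 1 := by
  have h1 := Nat.one_le_two_pow (n := m)
  have h2 : n + 2 ^ m ≤ (n + 1 + 1) * 2 ^ m - 1 := by
    have : n + 1 ≤ (n + 1) * 2 ^ m := Nat.le_mul_of_pos_right _ h1
    rw [add_mul (n + 1)]
    omega
  have h3 := Nat.pow_le_pow_right (n := 2) (by norm_num) h2
  have h4 := Nat.one_le_two_pow (n := n)
  rw [Nat.mul_sub, ← pow_add]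
  omega

end SOChase

theorem mainTheorem10 :
    ∃ (D : ℕ → SOChase.Database) (S : ℕ → ℕ → Set SOChase.TGD),
      (∀ ℓ : ℕ, 0 < ℓ → (D ℓ).card = ℓ) ∧
      (∀ n m : ℕ, 0 < n → 0 < m →
        S n m ∈ SOChase.ClassG ∧
        SOChase.VarDisjoint (S n m) ∧
        (n : ℚ) = ((SOChase.sch (S n m)).ncard : ℚ) / 4 - 3 ∧
        (m : ℚ) = (SOChase.maxArity (S n m) : ℚ) / 2 - 2) ∧
      (∀ ℓ n m : ℕ, 0 < ℓ → 0 < n → 0 < m →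
        S n m ∈ SOChase.CTforall (D ℓ) ∧
        S n m ∈ SOChase.CTexists (D ℓ) ∧
        ∀ J : SOChase.Instance, SOChase.IsChaseResult (D ℓ) (S n m) J →
          J.Finite ∧ ℓ * 2 ^ (2 ^ n * (2 ^ (2 ^ m) - 1)) ≤ J.ncard) := by
  refine ⟨SOChase.counterDB, fun n m => SOChase.counterTGDs (n + 1) m, fun ℓ _ => ?_,
    fun n m _ _ => ⟨SOChase.counterTGDs_mem_ClassG _ _, SOChase.varDisjoint_counterTGDs _ _, ?_, ?_⟩,
    fun ℓ n m _ _ _ => ?_⟩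
  · rw [SOChase.counterDB, Finset.card_map, Finset.card_range]
  · rw [SOChase.ncard_sch_counterTGDs]
    push_cast
    ring
  · rw [SOChase.maxArity_counterTGDs]
    push_cast
    ring
  · have hfin := SOChase.finite_counterModel (n + 1) m ℓ
    have hclosed := SOChase.isClosedUnder_counterModel (n + 1) m ℓ
    have hD : (SOChase.counterDB ℓ).toInstance ⊆ SOChase.counterModel (n + 1) m ℓ := by
      intro α hα
      obtain ⟨i, hi, rfl⟩ := SOChase.mem_toInstance_counterDB.1 hα
      exact .inl ⟨i, hi, rfl⟩
    refine ⟨SOChase.mem_CTforall_of_isClosedUnder hfin hclosed hD,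
      SOChase.mem_CTexists_of_isClosedUnder hfin hclosed hD, fun J hJ => ?_⟩
    obtain ⟨hJc, hDJ, hJM⟩ := hJ.closed_and_subset hfin hclosed hD
    have hJfin := hfin.subset hJM
    refine ⟨hJfin, le_trans ?_ (hJc.le_ncard hJfin fun i hi =>
      hDJ (SOChase.mem_toInstance_counterDB.2 ⟨i, hi, rfl⟩))⟩
    exact Nat.mul_le_mul_left _ (Nat.pow_le_pow_right (by norm_num) (SOChase.two_pow_mul_le n m))
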